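/- Let $k$ be an algebraically closed field and $Q$ a finite quiver with vertex set $Q_0$ and arrow set $Q_1$. Let $kQ$ be its path algebra, let $J(Q)\subset kQ$ be the two-sided ideal generated by the arrows, and let $I\subset kQ$ be an admissible ideal, i.e. a two-sided ideal with $J(Q)^{\ell}\subseteq I\subseteq J(Q)^2$ for some $\ell\ge 2$. Put $B=kQ/I$, $T_2Q=kQ/J(Q)^2$ and $n=\dim_k T_2Q$, and let $\operatorname{msa}(Q)$ be the set of all $(n-1)$-dimensional unital subalgebras of $T_2Q$. Every $\phi\in\operatorname{Aut}_k(B)$ induces a unique automorphism $\bar\phi\in\operatorname{Aut}_k(T_2Q)$ with $\bar\phi\circ\pi=\pi\circ\phi$, where $\pi:B\to T_2Q$ is the canonical projection, and $\operatorname{Aut}_k(B)$ acts on $\operatorname{msa}(Q)$ by $\phi\cdot A=\bar\phi(A)$. If one of the following conditions holds, then $\operatorname{msa}(Q)$ is a finite union of $\operatorname{Aut}_k(B)$-orbits: 1. $Q$ is Schur, i.e. for every ordered pair $(u,v)\in Q_0\times Q_0$ there is at most one arrow from $u$ to $v$; 2. $I$ is monomial, i.e. $I$ is generated, as a two-sided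 ideal, by a set of paths. -/

import Mathlib

universe u v w

/-- The type of all paths of a quiver, including a trivial path at each vertex. -/
abbrev QuiverPath (V : Type u) [Quiver.{v} V] : Type (max u v) :=
  Σ a b : V, Quiver.Path a b

/-- The underlying vector space of the path algebra `kQ`: formal `k`-linear combinations of paths
of the quiver. -/
def PathAlgebra (k : Type w) [Field k] (V : Type u) [Quiver.{v} V] : Type (max u v w) :=
  QuiverPath V →₀ k

namespace PathAlgebra

noncomputable section

variable (k : Type w) [Field k] {V : Type u} [Quiver.{v} V]

instance : AddCommGroup (PathAlgebra k V) := inferInstanceAs (AddCommGroup (QuiverPath V →₀ k))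

instance : Module k (PathAlgebra k V) := inferInstanceAs (Module k (QuiverPath V →₀ k))

/-- The basis of the path algebra given by the paths. -/
def basis : Module.Basis (QuiverPath V) k (PathAlgebra k V) :=
  Module.Basis.ofRepr (LinearEquiv.refl k (QuiverPath V →₀ k))

/-- A path, as an element of the path algebra. -/
def ofPath {a b : V} (p : Quiver.Path a b) : PathAlgebra k V := basis k ⟨a, b, p⟩

/-- An arrow, as an element of the path algebra. -/
def ofArrow {a b : V} (e : a ⟶ b) : PathAlgebra k V := ofPath k e.toPath

open Classical in
/-- The product of two paths: the concatenation (first `p`, then `q`) if `p` ends where `q` starts,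
and `0` otherwise. -/
def pathMul (p q : QuiverPath V) : PathAlgebra k V :=
  if h : p.2.1 = q.1 then ofPath k (p.2.2.comp (q.2.2.cast h.symm rfl)) else 0

/-- The multiplication of the path algebra: the bilinear extension of the product of paths. -/
def mulMap : PathAlgebra k V →ₗ[k] PathAlgebra k V →ₗ[k] PathAlgebra k V :=
  (basis k).constr k fun p => (basis k).constr k fun q => pathMul k p q

instance : Mul (PathAlgebra k V) := ⟨fun x y => mulMap k x y⟩

/-- The unit of the path algebra: the sum of the trivial paths. -/
instance [Fintype V] : One (PathAlgebra k V) := ⟨∑ a : V, ofPath k (Quiver.Path.nil : Quiver.Path a a)⟩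

theorem mul_def (x y : PathAlgebra k V) : x * y = mulMap k x y := rfl

theorem one_def [Fintype V] :
    (1 : PathAlgebra k V) = ∑ a : V, ofPath k (Quiver.Path.nil : Quiver.Path a a) := rfl

theorem ofPath_mul_ofPath {a b c : V} (p : Quiver.Path a b) (q : Quiver.Path b c) :
    ofPath k p * ofPath k q = ofPath k (p.comp q) := by
  simp [mul_def, mulMap, ofPath, pathMul]

theorem ofPath_mul_ofPath_of_ne {a b c d : V} (p : Quiver.Path a b) (q : Quiver.Path c d)
    (h : b ≠ c) : ofPath k p * ofPath k q = 0 := by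
  simp [mul_def, mulMap, ofPath, pathMul, h]

theorem induction {P : PathAlgebra k V → Prop} (x : PathAlgebra k V) (h0 : P 0)
    (hadd : ∀ x y, P x → P y → P (x + y))
    (hpath : ∀ (c : k) (a b : V) (p : Quiver.Path a b), P (c • ofPath k p)) : P x := by
  have hx : x ∈ Submodule.span k (Set.range (basis k (V := V))) := by
    rw [(basis k).span_eq]; trivial
  suffices h : ∀ c : k, P (c • x) by simpa using h 1
  induction hx using Submodule.span_induction with
  | mem x hx => obtain ⟨⟨a, b, p⟩, rfl⟩ := hx; exact fun c => hpath c a b p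
  | zero => intro c; simpa using h0
  | add x y _ _ hx hy => intro c; rw [smul_add]; exact hadd _ _ (hx c) (hy c)
  | smul d x _ hx => intro c; rw [smul_smul]; exact hx _

instance : NonUnitalNonAssocRing (PathAlgebra k V) where
  left_distrib x y z := by simp [mul_def]
  right_distrib x y z := by simp [mul_def]
  zero_mul x := by simp [mul_def]
  mul_zero x := by simp [mul_def]

theorem smul_mul (c : k) (x y : PathAlgebra k V) : c • x * y = c • (x * y) := by
  simp [mul_def]

theorem mul_smul' (c : k) (x y : PathAlgebra k V) : x * c • y = c • (x * y) := by
  simp [mul_def]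

theorem ofPath_assoc {a b c d e f : V} (p : Quiver.Path a b) (q : Quiver.Path c d)
    (r : Quiver.Path e f) :
    ofPath k p * ofPath k q * ofPath k r = ofPath k p * (ofPath k q * ofPath k r) := by
  by_cases h : b = c
  · subst h
    by_cases h' : d = e
    · subst h'
      simp [ofPath_mul_ofPath]
    · rw [ofPath_mul_ofPath, ofPath_mul_ofPath_of_ne k _ _ h', ofPath_mul_ofPath_of_ne k _ _ h',
        mul_zero]
  · rw [ofPath_mul_ofPath_of_ne k _ _ h, zero_mul]
    by_cases h' : d = e
    · subst h'
      rw [ofPath_mul_ofPath, ofPath_mul_ofPath_of_ne k _ _ h]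
    · rw [ofPath_mul_ofPath_of_ne k _ _ h', mul_zero]

theorem one_mul' [Fintype V] (x : PathAlgebra k V) : 1 * x = x := by
  induction x using induction with
  | h0 => simp
  | hadd x y hx hy => rw [mul_add, hx, hy]
  | hpath c a b p =>
    rw [mul_smul', one_def, Finset.sum_mul, Finset.sum_eq_single a]
    · rw [ofPath_mul_ofPath, Quiver.Path.nil_comp]
    · intro d _ h; exact ofPath_mul_ofPath_of_ne k _ _ h
    · simp

theorem mul_one' [Fintype V] (x : PathAlgebra k V) : x * 1 = x := by
  induction x using induction with
  | h0 => simp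
  | hadd x y hx hy => rw [add_mul, hx, hy]
  | hpath c a b p =>
    rw [smul_mul, one_def, Finset.mul_sum, Finset.sum_eq_single b]
    · rw [ofPath_mul_ofPath, Quiver.Path.comp_nil]
    · intro d _ h; exact ofPath_mul_ofPath_of_ne k _ _ h.symm
    · simp

theorem mul_assoc' (x y z : PathAlgebra k V) : x * y * z = x * (y * z) := by
  induction x using induction with
  | h0 => simp
  | hadd x x' hx hy => rw [add_mul, add_mul, add_mul, hx, hy]
  | hpath c a b p =>
    rw [smul_mul, smul_mul, smul_mul]; congr 1
    induction y using induction with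
    | h0 => simp
    | hadd x x' hx hy => rw [mul_add, add_mul, add_mul, mul_add, hx, hy]
    | hpath c a b p =>
      rw [smul_mul, mul_smul', mul_smul', smul_mul]; congr 1
      induction z using induction with
      | h0 => simp
      | hadd x x' hx hy => rw [mul_add, mul_add, mul_add, hx, hy]
      | hpath c a b p =>
        rw [mul_smul', mul_smul', mul_smul', ofPath_assoc]

instance [Fintype V] : Ring (PathAlgebra k V) where
  __ := (inferInstance : NonUnitalNonAssocRing (PathAlgebra k V))
  mul_assoc := mul_assoc' k
  one_mul := one_mul' k
  mul_one := mul_one' k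

instance [Fintype V] : Algebra k (PathAlgebra k V) :=
  Algebra.ofModule (smul_mul k) (mul_smul' k)

variable [Fintype V]

variable (V) in
/-- The ideal `J(Q)`: the two-sided ideal of the path algebra generated by the arrows. -/
def arrowIdeal : Ideal (PathAlgebra k V) :=
  (TwoSidedIdeal.span {x | ∃ (a b : V) (e : a ⟶ b), x = ofArrow k e}).asIdeal

instance : (arrowIdeal k V).IsTwoSided := by unfold arrowIdeal; infer_instance

open Classical in
/-- The character `kQ → k` that reads off the coefficient of the trivial path at `a`. -/
def vertexChar (a : V) : PathAlgebra k V →ₐ[k] k :=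
  AlgHom.ofLinearMap
    ((basis k).constr k fun p => if p = ⟨a, a, Quiver.Path.nil⟩ then 1 else 0)
    (by
      rw [one_def, map_sum, Finset.sum_eq_single a]
      · simp [ofPath]
      · intro b _ h; simp [ofPath, h]
      · simp)
    (by
      intro x y
      induction x using induction with
      | h0 => simp
      | hadd x x' hx hy => rw [add_mul, map_add, map_add, add_mul, hx, hy]
      | hpath c b b' p =>
        rw [smul_mul, map_smul, map_smul, smul_mul_assoc]; congr 1
        induction y using induction with
        | h0 => simp
        | hadd x x' hx hy => rw [mul_add, map_add, map_add, mul_add, hx, hy]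
        | hpath c d d' q =>
          rw [mul_smul', map_smul, map_smul, mul_smul_comm]; congr 1
          by_cases h : b' = d
          · subst h
            rw [ofPath_mul_ofPath]
            simp only [ofPath, Module.Basis.constr_basis]
            cases q with
            | cons q e =>
              rw [if_neg, if_neg (c := (⟨b', d', q.cons e⟩ : QuiverPath V) = _), mul_zero]
              · intro h
                have := congrArg (fun p : QuiverPath V => p.2.2.length) h
                simp at this
              · intro h
                have := congrArg (fun p : QuiverPath V => p.2.2.length) h
                simp at this
            | nil =>
              rw [Quiver.Path.comp_nil]
              split_ifs with h1 h2 h2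
              · simp
              · exfalso; apply h2; cases h1; rfl
              · simp
              · simp
          · rw [ofPath_mul_ofPath_of_ne k _ _ h, map_zero]
            simp only [ofPath, Module.Basis.constr_basis]
            split_ifs with h1 h2
            · exfalso; apply h; cases h1; cases h2; rfl
            all_goals simp)

theorem vertexChar_nil (a : V) : vertexChar k a (ofPath k (Quiver.Path.nil : Quiver.Path a a)) = 1 := by
  simp [vertexChar, ofPath]

theorem vertexChar_ne {a b c : V} (p : Quiver.Path b c)
    (h : (⟨b, c, p⟩ : QuiverPath V) ≠ ⟨a, a, Quiver.Path.nil⟩) :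
    vertexChar k a (ofPath k p) = 0 := by
  simp [vertexChar, ofPath, h]

theorem ofArrow_mem {a b : V} (e : a ⟶ b) : ofArrow k e ∈ arrowIdeal k V := by
  rw [arrowIdeal, TwoSidedIdeal.mem_asIdeal]
  exact TwoSidedIdeal.subset_span ⟨a, b, e, rfl⟩

theorem mem_arrowIdeal_iff (x : PathAlgebra k V) :
    x ∈ arrowIdeal k V ↔ ∀ a, vertexChar k a x = 0 := by
  constructor
  · intro hx a
    rw [arrowIdeal, TwoSidedIdeal.mem_asIdeal] at hx
    have : TwoSidedIdeal.span {x | ∃ (a b : V) (e : a ⟶ b), x = ofArrow k e} ≤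
        TwoSidedIdeal.ker (vertexChar k a) := by
      rw [TwoSidedIdeal.span_le]
      rintro _ ⟨b, c, e, rfl⟩
      rw [SetLike.mem_coe, TwoSidedIdeal.mem_ker]
      apply vertexChar_ne
      intro h
      have := congrArg (fun p : QuiverPath V => p.2.2.length) h
      simp at this
    exact (TwoSidedIdeal.mem_ker _).1 (this hx)
  · intro hx
    have key : ∀ x : PathAlgebra k V,
        x - ∑ a, vertexChar k a x • ofPath k (Quiver.Path.nil : Quiver.Path a a)
          ∈ arrowIdeal k V := by
      intro x
      induction x using induction with
      | h0 => simp
      | hadd x y hx hy =>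
        convert add_mem hx hy using 1
        simp only [map_add, add_smul, Finset.sum_add_distrib]
        abel
      | hpath c b b' p =>
        simp only [map_smul, smul_assoc, ← Finset.smul_sum, ← smul_sub]
        rw [← algebraMap_smul (PathAlgebra k V) c]
        apply Submodule.smul_mem
        cases p with
        | nil =>
          rw [Finset.sum_eq_single b]
          · simp [vertexChar_nil]
          · intro a _ h
            rw [vertexChar_ne, zero_smul]
            intro h'; cases h'; exact h rfl
          · simp
        | cons p e =>
          rw [Finset.sum_eq_zero, sub_zero]
          · have : ofPath k (p.cons e) = ofPath k p * ofArrow k e := by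
              rw [ofArrow, ofPath_mul_ofPath]; rfl
            rw [this]
            exact Ideal.mul_mem_left _ _ (ofArrow_mem k e)
          · intro a _
            rw [vertexChar_ne, zero_smul]
            intro h
            have := congrArg (fun p : QuiverPath V => p.2.2.length) h
            simp at this
    simpa [hx] using key x

end

end PathAlgebra

noncomputable section

open PathAlgebra

variable {k : Type w} [Field k] {V : Type u} [Quiver.{v} V] [Fintype V]

/-- An admissible ideal of the path algebra: `J(Q)^ℓ ⊆ I ⊆ J(Q)²` for some `ℓ ≥ 2`. -/
class IsAdmissibleIdeal (I : Ideal (PathAlgebra k V)) : Prop extends I.IsTwoSided where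
  le_sq : I ≤ arrowIdeal k V ^ 2
  exists_pow_le : ∃ l : ℕ, 2 ≤ l ∧ arrowIdeal k V ^ l ≤ I

/-- A monomial ideal: a two-sided ideal generated by a set of paths. -/
def IsMonomialIdeal (I : Ideal (PathAlgebra k V)) : Prop :=
  ∃ S : Set (QuiverPath V),
    I = (TwoSidedIdeal.span ((fun p : QuiverPath V => ofPath k p.2.2) '' S)).asIdeal

/-- A Schur quiver: at most one arrow between any ordered pair of vertices. -/
def IsSchurQuiver (V : Type u) [Quiver.{v} V] : Prop :=
  ∀ a b : V, Subsingleton (a ⟶ b)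

variable (k V) in
/-- The truncated quiver algebra `T_n Q = kQ / J(Q)^n`. -/
abbrev TruncatedQuiverAlgebra (n : ℕ) : Type (max u v w) :=
  PathAlgebra k V ⧸ arrowIdeal k V ^ n

/-- The set of `m`-dimensional (unital) subalgebras of a `k`-algebra `B`. -/
def AlgGr (k : Type*) [Field k] (B : Type*) [Ring B] [Algebra k B] (m : ℕ) :
    Set (Subalgebra k B) :=
  {A | Module.finrank k A = m}

variable (k V) in
/-- `msa(Q)`: the set of `(n-1)`-dimensional subalgebras of `T₂ Q`, where `n = dim T₂ Q`. -/
def msa : Set (Subalgebra k (TruncatedQuiverAlgebra k V 2)) :=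
  AlgGr k (TruncatedQuiverAlgebra k V 2)
    (Module.finrank k (TruncatedQuiverAlgebra k V 2) - 1)

section action

variable (I : Ideal (PathAlgebra k V)) [hI : IsAdmissibleIdeal I]

/-- The canonical projection `kQ/I → kQ/J(Q)² = T₂ Q`. -/
def toT2 : (PathAlgebra k V ⧸ I) →ₐ[k] TruncatedQuiverAlgebra k V 2 :=
  Ideal.Quotient.factorₐ k hI.le_sq

theorem toT2_mk (x : PathAlgebra k V) :
    toT2 I (Ideal.Quotient.mk I x) = Ideal.Quotient.mk (arrowIdeal k V ^ 2) x := rfl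

theorem toT2_surjective : Function.Surjective (toT2 I) := by
  intro y
  obtain ⟨x, rfl⟩ := Ideal.Quotient.mk_surjective y
  exact ⟨Ideal.Quotient.mk I x, rfl⟩

theorem aut_arrowIdeal (φ : (PathAlgebra k V ⧸ I) ≃ₐ[k] (PathAlgebra k V ⧸ I))
    (x y : PathAlgebra k V) (hx : x ∈ arrowIdeal k V)
    (h : φ (Ideal.Quotient.mk I x) = Ideal.Quotient.mk I y) : y ∈ arrowIdeal k V := by
  obtain ⟨l, hl, hle⟩ := hI.exists_pow_le
  have h1 : φ (Ideal.Quotient.mk I x) ^ l = 0 := by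
    rw [← map_pow, ← map_pow, Ideal.Quotient.eq_zero_iff_mem.2 (hle (Ideal.pow_mem_pow hx l)),
      map_zero]
  rw [h, ← map_pow, Ideal.Quotient.eq_zero_iff_mem] at h1
  have h2 : y ^ l ∈ arrowIdeal k V := Ideal.pow_le_self two_ne_zero (hI.le_sq h1)
  rw [mem_arrowIdeal_iff] at h2 ⊢
  intro a
  have := h2 a
  rw [map_pow] at this
  exact pow_eq_zero_iff (by omega) |>.1 this

theorem toT2_aut_eq_zero (φ : (PathAlgebra k V ⧸ I) ≃ₐ[k] (PathAlgebra k V ⧸ I))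
    (x : PathAlgebra k V) (hx : x ∈ arrowIdeal k V ^ 2) :
    toT2 I (φ (Ideal.Quotient.mk I x)) = 0 := by
  rw [Submodule.pow_succ, Submodule.pow_one] at hx
  refine Submodule.mul_induction_on hx ?_ ?_
  · intro a ha b hb
    obtain ⟨a', ha'⟩ := Ideal.Quotient.mk_surjective (φ (Ideal.Quotient.mk I a))
    obtain ⟨b', hb'⟩ := Ideal.Quotient.mk_surjective (φ (Ideal.Quotient.mk I b))
    rw [map_mul, map_mul, ← ha', ← hb', ← map_mul, toT2_mk, Ideal.Quotient.eq_zero_iff_mem,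
      Submodule.pow_succ, Submodule.pow_one]
    exact Ideal.mul_mem_mul (aut_arrowIdeal I φ a a' ha ha'.symm)
      (aut_arrowIdeal I φ b b' hb hb'.symm)
  · intro a b ha hb
    rw [map_add, map_add, map_add, ha, hb, add_zero]

/-- The endomorphism of `T₂ Q` induced by an automorphism of `kQ/I`. -/
def inducedEnd (φ : (PathAlgebra k V ⧸ I) ≃ₐ[k] (PathAlgebra k V ⧸ I)) :
    TruncatedQuiverAlgebra k V 2 →ₐ[k] TruncatedQuiverAlgebra k V 2 :=
  Ideal.Quotient.liftₐ (arrowIdeal k V ^ 2)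
    (((toT2 I).comp φ.toAlgHom).comp (Ideal.Quotient.mkₐ k I)) (toT2_aut_eq_zero I φ)

theorem inducedEnd_toT2 (φ : (PathAlgebra k V ⧸ I) ≃ₐ[k] (PathAlgebra k V ⧸ I))
    (x : PathAlgebra k V ⧸ I) : inducedEnd I φ (toT2 I x) = toT2 I (φ x) := by
  obtain ⟨x, rfl⟩ := Ideal.Quotient.mk_surjective x
  rfl

/-- The group homomorphism `Aut_k(kQ/I) → Aut_k(T₂ Q)`; the image of `φ` is the automorphism
`ψ` with `ψ ∘ π = π ∘ φ`, where `π : kQ/I → T₂ Q` is the canonical projection. -/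
def inducedAut : ((PathAlgebra k V ⧸ I) ≃ₐ[k] (PathAlgebra k V ⧸ I)) →*
    (TruncatedQuiverAlgebra k V 2 ≃ₐ[k] TruncatedQuiverAlgebra k V 2) where
  toFun φ := AlgEquiv.ofAlgHom (inducedEnd I φ) (inducedEnd I φ⁻¹)
    (by
      ext x
      obtain ⟨x, rfl⟩ := toT2_surjective I x
      rw [AlgHom.comp_apply, inducedEnd_toT2, inducedEnd_toT2, ← AlgEquiv.mul_apply,
        mul_inv_cancel]; rfl)
    (by
      ext x
      obtain ⟨x, rfl⟩ := toT2_surjective I x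
      rw [AlgHom.comp_apply, inducedEnd_toT2, inducedEnd_toT2, ← AlgEquiv.mul_apply,
        inv_mul_cancel]; rfl)
  map_one' := by
    ext x
    obtain ⟨x, rfl⟩ := toT2_surjective I x
    exact inducedEnd_toT2 I 1 x
  map_mul' φ ψ := by
    ext x
    obtain ⟨x, rfl⟩ := toT2_surjective I x
    change inducedEnd I (φ * ψ) (toT2 I x) = inducedEnd I φ (inducedEnd I ψ (toT2 I x))
    rw [inducedEnd_toT2, inducedEnd_toT2, inducedEnd_toT2]; rfl

theorem inducedAut_toT2 (φ : (PathAlgebra k V ⧸ I) ≃ₐ[k] (PathAlgebra k V ⧸ I))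
    (x : PathAlgebra k V ⧸ I) : inducedAut I φ (toT2 I x) = toT2 I (φ x) :=
  inducedEnd_toT2 I φ x

/-- The action of `Aut_k(kQ/I)` on `msa(Q)`: an automorphism `φ` sends `A` to the image of `A`
under the automorphism of `T₂ Q` induced by `φ`. -/
instance msaAction : MulAction ((PathAlgebra k V ⧸ I) ≃ₐ[k] (PathAlgebra k V ⧸ I)) (msa k V) where
  smul φ A := ⟨A.1.map (inducedAut I φ).toAlgHom, by
    have h : Module.finrank k A.1 = _ := A.2
    change Module.finrank k _ = _
    rw [← h]
    exact (((inducedAut I φ).subalgebraMap A.1).toLinearEquiv.finrank_eq).symm⟩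
  one_smul A := by
    apply Subtype.ext
    change A.1.map (inducedAut I 1).toAlgHom = A.1
    rw [map_one]
    exact Subalgebra.map_id A.1
  mul_smul φ ψ A := by
    apply Subtype.ext
    change A.1.map (inducedAut I (φ * ψ)).toAlgHom =
      (A.1.map (inducedAut I ψ).toAlgHom).map
        (inducedAut I φ).toAlgHom
    rw [map_mul, Subalgebra.map_map]
    rfl

end action

end

/-! The radical of $T_2Q$ is the common kernel of the vertex characters, and its square is zero. A
codimension-one subalgebra is the kernel of a functional $f$, and closure under products leaves two
cases.

If $f$ kills the radical, then $f$ is a combination of characters, and $A$ is the locus where two of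
them agree (`exists_eq_equalizer`). There are finitely many such $A$.

Otherwise $A\cap\operatorname{rad}$ is a two-sided ideal of codimension one in the radical, so on
arrows $f$ lives on those from one vertex $u$ to one vertex $v$ (`exists_radical_element`).
Conjugation by a suitable $1+m$ with $m$ radical makes the functional vanish on all vertices
(`exists_normal_form`), a concrete instance of Wedderburn–Malcev. Since the arrow ideal is nilpotent
modulo $I$, this conjugation lifts to $kQ/I$ (`exists_aut_conj`).

What remains is a functional on the span of the arrows $u\to v$. Its support is one of finitely many
sets of arrows and determines the orbit: for a Schur quiver the functional is unique up to a scalar;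
for monomial $I$ every rescaling of arrows descends to $kQ/I$ (`exists_aut_scaleArrows`) and adjusts
the nonzero coefficients at will. -/

noncomputable section

open PathAlgebra

/-! ### Vertices, arrows and characters of $T_2Q$. -/

namespace TruncatedQuiverAlgebra

variable {k : Type w} [Field k] {V : Type u} [Quiver.{v} V] [Fintype V]

variable (k) in
/-- The idempotent of `T₂ Q` at a vertex. -/
def vertex (a : V) : TruncatedQuiverAlgebra k V 2 :=
  Ideal.Quotient.mk _ (ofPath k (Quiver.Path.nil : Quiver.Path a a))

variable (k) in
/-- The class of an arrow in `T₂ Q`. -/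
def arrow {a b : V} (e : a ⟶ b) : TruncatedQuiverAlgebra k V 2 :=
  Ideal.Quotient.mk _ (ofArrow k e)

theorem mk_mul_eq_zero {x y : PathAlgebra k V} (hx : x ∈ arrowIdeal k V)
    (hy : y ∈ arrowIdeal k V) :
    (Ideal.Quotient.mk (arrowIdeal k V ^ 2) x) * Ideal.Quotient.mk (arrowIdeal k V ^ 2) y = 0 := by
  rw [← map_mul, Ideal.Quotient.eq_zero_iff_mem, Submodule.pow_succ, Submodule.pow_one]
  exact Ideal.mul_mem_mul hx hy

variable (k) in
/-- The character of `T₂ Q` at a vertex. -/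
def character (a : V) : TruncatedQuiverAlgebra k V 2 →ₐ[k] k :=
  Ideal.Quotient.liftₐ (arrowIdeal k V ^ 2) (vertexChar k a) fun x hx =>
    (mem_arrowIdeal_iff k x).1 (Ideal.pow_le_self two_ne_zero hx) a

/-- This is $\operatorname{rad}^2=0$, with membership in the radical tested by characters; it makes
the later product computations collapse. -/
theorem mul_eq_zero_of_character {x y : TruncatedQuiverAlgebra k V 2}
    (hx : ∀ a, character k a x = 0) (hy : ∀ a, character k a y = 0) : x * y = 0 := by
  obtain ⟨x, rfl⟩ := Ideal.Quotient.mk_surjective x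
  obtain ⟨y, rfl⟩ := Ideal.Quotient.mk_surjective y
  exact mk_mul_eq_zero ((mem_arrowIdeal_iff k x).2 hx) ((mem_arrowIdeal_iff k y).2 hy)

theorem character_vertex_self (a : V) : character k a (vertex k a) = 1 := vertexChar_nil k a

theorem character_vertex_of_ne {a b : V} (h : a ≠ b) : character k a (vertex k b) = 0 := by
  apply vertexChar_ne
  intro h'
  cases h'
  exact h rfl

theorem character_arrow (c : V) {a b : V} (e : a ⟶ b) : character k c (arrow k e) = 0 :=
  (mem_arrowIdeal_iff k _).1 (ofArrow_mem k e) c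

theorem vertex_mul_self (a : V) : vertex k a * vertex k a = vertex k a := by
  rw [vertex, ← map_mul, ofPath_mul_ofPath, Quiver.Path.comp_nil]

theorem vertex_mul_of_ne {a b : V} (h : a ≠ b) : vertex k a * vertex k b = 0 := by
  rw [vertex, vertex, ← map_mul, ofPath_mul_ofPath_of_ne k _ _ h, map_zero]

theorem vertex_mul_arrow {a b : V} (e : a ⟶ b) : vertex k a * arrow k e = arrow k e := by
  rw [vertex, arrow, ← map_mul, ofArrow, ofPath_mul_ofPath, Quiver.Path.nil_comp]

theorem arrow_mul_vertex {a b : V} (e : a ⟶ b) : arrow k e * vertex k b = arrow k e := by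
  rw [vertex, arrow, ← map_mul, ofArrow, ofPath_mul_ofPath, Quiver.Path.comp_nil]

variable (k V) in
theorem sum_vertex : ∑ a : V, vertex k a = 1 := by
  simp only [vertex]
  rw [← map_sum, ← one_def, map_one]

theorem mk_ofPath_mem_span {a b : V} (p : Quiver.Path a b) :
    Ideal.Quotient.mk (arrowIdeal k V ^ 2) (ofPath k p) ∈ Submodule.span k
      (Set.range (vertex k (V := V)) ∪
        Set.range fun e : Σ a b : V, (a ⟶ b) => arrow k e.2.2) := by
  match p with
  | .nil => exact Submodule.subset_span (Or.inl ⟨a, rfl⟩)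
  | .cons .nil e => exact Submodule.subset_span (Or.inr ⟨⟨_, _, e⟩, rfl⟩)
  | .cons (.cons p e) e' =>
    have h : ofPath k ((p.cons e).cons e') = ofPath k p * ofArrow k e * ofArrow k e' := by
      rw [ofArrow, ofArrow, ofPath_mul_ofPath, ofPath_mul_ofPath]; rfl
    rw [h, map_mul, mk_mul_eq_zero (Ideal.mul_mem_left _ _ (ofArrow_mem k e)) (ofArrow_mem k e')]
    exact zero_mem _

variable (k V) in
theorem span_vertex_arrow : Submodule.span k
    (Set.range (vertex k (V := V)) ∪
      Set.range fun e : Σ a b : V, (a ⟶ b) => arrow k e.2.2) = ⊤ := by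
  rw [eq_top_iff]
  rintro x -
  obtain ⟨x, rfl⟩ := Ideal.Quotient.mk_surjective x
  induction x using induction with
  | h0 => rw [map_zero]; exact zero_mem _
  | hadd x y hx hy => rw [map_add]; exact add_mem hx hy
  | hpath c a b p => exact Submodule.smul_mem _ c (mk_ofPath_mem_span p)

theorem linearMap_ext {M : Type*} [AddCommGroup M] [Module k M]
    {f g : TruncatedQuiverAlgebra k V 2 →ₗ[k] M} (hv : ∀ a, f (vertex k a) = g (vertex k a))
    (ha : ∀ (a b : V) (e : a ⟶ b), f (arrow k e) = g (arrow k e)) : f = g := by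
  apply LinearMap.ext_on (span_vertex_arrow k V)
  rintro _ (⟨a, rfl⟩ | ⟨⟨a, b, e⟩, rfl⟩)
  exacts [hv a, ha a b e]

instance [∀ a b : V, Finite (a ⟶ b)] : Module.Finite k (TruncatedQuiverAlgebra k V 2) := by
  refine Module.finite_def.2 ?_
  rw [← span_vertex_arrow k V]
  exact Submodule.fg_span ((Set.finite_range _).union (Set.finite_range _))

/-- Splits off the semisimple part of $x$, so that a functional killing the radical is determined by
its values on vertices. -/
theorem character_sub_sum (x : TruncatedQuiverAlgebra k V 2) (b : V) :
    character k b (x - ∑ a, character k a x • vertex k a) = 0 := by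
  rw [map_sub, map_sum, Finset.sum_eq_single b]
  · rw [map_smul, character_vertex_self, smul_eq_mul, mul_one, sub_self]
  · intro a _ h
    rw [map_smul, character_vertex_of_ne h.symm, smul_zero]
  · simp

/-! ### Subalgebras of codimension one. -/

/-- A subalgebra of `T₂ Q` that is a hyperplane containing the radical identifies two vertices. -/
theorem exists_eq_equalizer (A : Subalgebra k (TruncatedQuiverAlgebra k V 2))
    (f : TruncatedQuiverAlgebra k V 2 →ₗ[k] k) (hf : f ≠ 0) (hA : ∀ x, x ∈ A ↔ f x = 0)
    (hrad : ∀ x, (∀ a, character k a x = 0) → f x = 0) :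
    ∃ u v : V, A = AlgHom.equalizer (character k u) (character k v) := by
  have hfx (x) : f x = ∑ a, character k a x * f (vertex k a) := by
    have := hrad _ (character_sub_sum x)
    rw [map_sub, map_sum, sub_eq_zero] at this
    simpa using this
  have h1 : ∑ a : V, f (vertex k a) = 0 := by
    rw [← map_sum, sum_vertex]
    exact (hA 1).1 A.one_mem
  obtain ⟨u, hu⟩ : ∃ u : V, f (vertex k u) ≠ 0 := by
    by_contra! h
    exact hf (LinearMap.ext fun x => by simp [hfx x, h])
  obtain ⟨v, hvu, hv⟩ : ∃ v : V, v ≠ u ∧ f (vertex k v) ≠ 0 := by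
    by_contra! h
    apply hu
    rw [← h1]
    exact (Finset.sum_eq_single u (fun b _ hb => h b hb) (by simp)).symm
  -- A third vertex $w$ in the support would give two elements of $A$ whose product is
  -- $f(e_u)^{-2}e_u$, which is not in $A$.
  have hw (w : V) (hwu : w ≠ u) (hwv : w ≠ v) : f (vertex k w) = 0 := by
    by_contra hw
    have key (b : V) (hb : f (vertex k b) ≠ 0) :
        (f (vertex k u))⁻¹ • vertex k u - (f (vertex k b))⁻¹ • vertex k b ∈ A := by
      rw [hA]
      simp [hu, hb]
    have := (hA _).1 (A.mul_mem (key w hw) (key v hv))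
    simp only [mul_sub, sub_mul, smul_mul_assoc, mul_smul_comm, vertex_mul_self,
      vertex_mul_of_ne hwu, vertex_mul_of_ne hvu.symm, vertex_mul_of_ne hwv] at this
    simp [hu] at this
  have hsum (x) : f x = character k u x * f (vertex k u) + character k v x * f (vertex k v) := by
    rw [hfx x]
    exact Fintype.sum_eq_add u v hvu.symm fun w h => by rw [hw w h.1 h.2, mul_zero]
  refine ⟨u, v, ?_⟩
  have h2 : f (vertex k u) + f (vertex k v) = 0 := by
    have := (hA 1).1 A.one_mem
    rwa [hsum, map_one, map_one, one_mul, one_mul] at this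
  refine SetLike.ext fun x => ?_
  rw [hA, AlgHom.mem_equalizer, hsum, eq_neg_of_add_eq_zero_right h2, mul_neg, ← sub_eq_add_neg,
    ← sub_mul, mul_eq_zero, or_iff_left hu, sub_eq_zero]

/-- A functional on `T₂ Q` whose kernel is a subalgebra that does not contain the radical is
concentrated on the arrows between two fixed vertices, up to a radical element that is normalized
for it. -/
theorem exists_radical_element (A : Subalgebra k (TruncatedQuiverAlgebra k V 2))
    (f : TruncatedQuiverAlgebra k V 2 →ₗ[k] k) (hA : ∀ x, x ∈ A ↔ f x = 0)
    (hrad : ∃ x, (∀ a, character k a x = 0) ∧ f x ≠ 0) :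
    ∃ (u v : V) (j : TruncatedQuiverAlgebra k V 2), (∀ a, character k a j = 0) ∧ f j = 1 ∧
      vertex k u * j = j ∧ j * vertex k v = j ∧
      (∀ x, (∀ a, character k a x = 0) →
        (∀ a, a ≠ u → f (vertex k a * x) = 0) ∧ ∀ b, b ≠ v → f (x * vertex k b) = 0) := by
  obtain ⟨x, hx, hfx⟩ := hrad
  -- Some Peirce component $e_u x e_v$ survives under $f$; normalized, it becomes $j$.
  obtain ⟨u, v, huv⟩ : ∃ u v : V, f (vertex k u * x * vertex k v) ≠ 0 := by
    by_contra! h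
    apply hfx
    have : x = ∑ u : V, ∑ v : V, vertex k u * x * vertex k v := by
      simp_rw [← Finset.mul_sum, ← Finset.sum_mul, sum_vertex, one_mul, mul_one]
    rw [this]
    simp [h]
  obtain ⟨j, hj⟩ : ∃ j, j = (f (vertex k u * x * vertex k v))⁻¹ • (vertex k u * x * vertex k v) :=
    ⟨_, rfl⟩
  have hjr (a : V) : character k a j = 0 := by simp [hj, hx]
  have hfj : f j = 1 := by simp [hj, huv]
  have huj : vertex k u * j = j := by
    rw [hj, mul_smul_comm, ← mul_assoc, ← mul_assoc, vertex_mul_self]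
  have hjv : j * vertex k v = j := by
    rw [hj, smul_mul_assoc, mul_assoc (_ * x), vertex_mul_self]
  -- $A\cap\operatorname{rad}$ absorbs every $b$: correct $b$ to $b-f(b)j\in A$, and the correction
  -- disappears because $jy=0$.
  have hleft (b y) (hy : ∀ a, character k a y = 0) (hfy : f y = 0) : f (b * y) = 0 := by
    have hb : b - f b • j ∈ A := by simp [hA, hfj]
    have := (hA _).1 (A.mul_mem hb ((hA y).2 hfy))
    rwa [sub_mul, smul_mul_assoc, mul_eq_zero_of_character hjr hy, smul_zero, sub_zero] at this
  have hright (b y) (hy : ∀ a, character k a y = 0) (hfy : f y = 0) : f (y * b) = 0 := by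
    have hb : b - f b • j ∈ A := by simp [hA, hfj]
    have := (hA _).1 (A.mul_mem ((hA y).2 hfy) hb)
    rwa [mul_sub, mul_smul_comm, mul_eq_zero_of_character hy hjr, smul_zero, sub_zero] at this
  refine ⟨u, v, j, hjr, hfj, huj, hjv, fun y hy => ?_⟩
  have hy' (a : V) : character k a (y - f y • j) = 0 := by simp [hy, hjr]
  have hfy : f (y - f y • j) = 0 := by simp [hfj]
  constructor
  -- Modulo $A\cap\operatorname{rad}$, $y$ is a multiple of $j=e_uj$, which $e_a$ kills.
  · intro a ha
    have := hleft (vertex k a) _ hy' hfy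
    rwa [← huj, mul_sub, mul_smul_comm, ← mul_assoc, vertex_mul_of_ne ha, zero_mul, smul_zero,
      sub_zero] at this
  · intro b hb
    have := hright (vertex k b) _ hy' hfy
    rwa [← hjv, sub_mul, smul_mul_assoc, mul_assoc, vertex_mul_of_ne hb.symm, mul_zero, smul_zero,
      sub_zero] at this

/-- A hyperplane subalgebra of `T₂ Q` that does not contain the radical contains all vertices after
conjugation by `1 + m` with `m` in the radical, and it is then the kernel of a functional that is
supported on the arrows between two fixed vertices. -/
theorem exists_normal_form (A : Subalgebra k (TruncatedQuiverAlgebra k V 2))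
    (f : TruncatedQuiverAlgebra k V 2 →ₗ[k] k) (hA : ∀ x, x ∈ A ↔ f x = 0)
    (hrad : ∃ x, (∀ a, character k a x = 0) ∧ f x ≠ 0) :
    ∃ (u v : V) (m : TruncatedQuiverAlgebra k V 2) (g : TruncatedQuiverAlgebra k V 2 →ₗ[k] k),
      (∀ a, character k a m = 0) ∧ (∀ x, (1 + m) * x * (1 - m) ∈ A ↔ g x = 0) ∧
      (∀ a, g (vertex k a) = 0) ∧
      ∀ (a b : V) (e : a ⟶ b), g (arrow k e) ≠ 0 → a = u ∧ b = v := by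
  obtain ⟨u, v, j, hjr, hfj, huj, hjv, hideal⟩ := exists_radical_element A f hA hrad
  have hju (b : V) (hb : b ≠ v) : j * vertex k b = 0 := by
    rw [← hjv, mul_assoc, vertex_mul_of_ne hb.symm, mul_zero]
  have hvj (a : V) (ha : a ≠ u) : vertex k a * j = 0 := by
    rw [← huj, ← mul_assoc, vertex_mul_of_ne ha, zero_mul]
  have hjj : j * j = 0 := mul_eq_zero_of_character hjr hjr
  -- Closure of $A$ under the product of $e_a-f(e_a)j$ and $e_b-f(e_b)j$, expanded using $j^2=0$.
  have hprod (a b : V) : f (vertex k a * vertex k b) - f (vertex k b) * f (vertex k a * j) -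
      f (vertex k a) * f (j * vertex k b) = 0 := by
    have h (a : V) : vertex k a - f (vertex k a) • j ∈ A := by simp [hA, hfj]
    have := (hA _).1 (A.mul_mem (h a) (h b))
    simpa [mul_sub, sub_mul, hjj, sub_sub, add_comm] using this
  set t := f (vertex k u) with ht
  -- The left side is $f\bigl((1+tj)e_w(1-tj)\bigr)$. For $u\ne v$ its vanishing at $w=u$ forces
  -- $t=f(e_u)$; for $u=v$, `hprod` already gives $t=0$.
  have hconj (w : V) : f (vertex k w) + t * f (j * vertex k w) - t * f (vertex k w * j) = 0 := by
    by_cases huv : u = v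
    · subst huv
      have h0 : t = 0 := by
        have := hprod u u
        rw [vertex_mul_self, huj, hjv, hfj] at this
        linear_combination -this
      rw [h0, zero_mul, zero_mul, add_zero, sub_zero]
      by_cases hw : w = u
      · rw [hw, ← ht, h0]
      · have := hprod w w
        simpa [vertex_mul_self, hju w hw, hvj w hw] using this
    · by_cases hwu : w = u
      · subst hwu
        rw [hju w huv, huj, hfj, ← ht]
        simp
      · rw [hvj w hwu]
        by_cases hwv : w = v
        · subst hwv
          have := hprod u w
          rw [vertex_mul_of_ne huv, huj, hjv, hfj, map_zero, ← ht] at this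
          rw [hjv, hfj, map_zero]
          linear_combination -this
        · have := hprod w w
          rw [hju w hwv]
          simpa [vertex_mul_self, hju w hwv, hvj w hwu] using this
  refine ⟨u, v, t • j,
    f ∘ₗ LinearMap.mulLeft k (1 + t • j) ∘ₗ LinearMap.mulRight k (1 - t • j), ?_, ?_, ?_, ?_⟩
  · simp [hjr]
  · intro x
    rw [hA]
    simp [mul_assoc]
  · intro a
    have hz : j * (vertex k a * j) = 0 := mul_eq_zero_of_character hjr (by simp [hjr])
    have := hconj a
    simp [mul_sub, add_mul, hz]
    linear_combination this
  · intro a b e h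
    -- Conjugation by $1+tj$ fixes arrows, so the new functional agrees with $f$ on them.
    have h1 : j * arrow k e = 0 := mul_eq_zero_of_character hjr fun c => character_arrow c e
    have h2 : arrow k e * j = 0 := mul_eq_zero_of_character (fun c => character_arrow c e) hjr
    have h3 : f (arrow k e) ≠ 0 := by
      simpa [mul_sub, add_mul, h1, h2] using h
    obtain ⟨h4, h5⟩ := hideal (arrow k e) fun c => character_arrow c e
    constructor
    · by_contra hne
      exact h3 (by simpa [vertex_mul_arrow] using h4 a hne)
    · by_contra hne
      exact h3 (by simpa [arrow_mul_vertex] using h5 b hne)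

end TruncatedQuiverAlgebra

/-! ### Rescaling of arrows. -/

namespace PathAlgebra

variable {k : Type w} [Field k] {V : Type u} [Quiver.{v} V] [Fintype V]

/-- The endomorphism of the path algebra that multiplies every arrow by a scalar. -/
def scaleArrows (d : (Σ a b : V, (a ⟶ b)) → kˣ) : PathAlgebra k V →ₐ[k] PathAlgebra k V :=
  AlgHom.ofLinearMap
    ((basis k).constr k fun p => ((p.2.2.weight fun {a b} e => d ⟨a, b, e⟩ : kˣ) : k) •
      ofPath k p.2.2)
    (by simp [one_def, ofPath])
    (by
      intro x y
      induction x using induction with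
      | h0 => simp
      | hadd x x' hx hy => rw [add_mul, map_add, map_add, add_mul, hx, hy]
      | hpath c a b p =>
        rw [smul_mul, map_smul, map_smul, smul_mul_assoc]; congr 1
        induction y using induction with
        | h0 => simp
        | hadd x x' hx hy => rw [mul_add, map_add, map_add, mul_add, hx, hy]
        | hpath c a' b' q =>
          rw [mul_smul', map_smul, map_smul, mul_smul_comm]; congr 1
          by_cases h : b = a'
          · subst h
            rw [ofPath_mul_ofPath]
            simp only [ofPath, Module.Basis.constr_basis, Quiver.Path.weight_comp]
            rw [smul_mul_smul_comm, Units.val_mul]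
            congr 1
            exact (ofPath_mul_ofPath k p q).symm
          · rw [ofPath_mul_ofPath_of_ne k _ _ h, map_zero]
            simp only [ofPath, Module.Basis.constr_basis]
            rw [smul_mul_smul_comm]
            exact ((congrArg _ (ofPath_mul_ofPath_of_ne k p q h)).trans (smul_zero _)).symm)

theorem scaleArrows_ofPath (d : (Σ a b : V, (a ⟶ b)) → kˣ) {a b : V} (p : Quiver.Path a b) :
    scaleArrows d (ofPath k p) =
      ((p.weight fun {a b} e => d ⟨a, b, e⟩ : kˣ) : k) • ofPath k p := by
  simp [scaleArrows, ofPath]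

theorem scaleArrows_comp_of_mul_eq_one {d d' : (Σ a b : V, (a ⟶ b)) → kˣ} (h : d * d' = 1) :
    (scaleArrows d).comp (scaleArrows d') = AlgHom.id k (PathAlgebra k V) := by
  have hw {a b : V} (p : Quiver.Path a b) : (p.weight fun {a b} e => d ⟨a, b, e⟩) *
      (p.weight fun {a b} e => d' ⟨a, b, e⟩) = 1 := by
    induction p with
    | nil => simp
    | cons p e ih =>
      rw [Quiver.Path.weight_cons, Quiver.Path.weight_cons, mul_mul_mul_comm, ih, one_mul]
      exact congrFun h _
  refine AlgHom.ext fun x => ?_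
  induction x using induction with
  | h0 => simp
  | hadd x y hx hy => rw [map_add, map_add, hx, hy]
  | hpath c a b p =>
    rw [map_smul, map_smul, AlgHom.comp_apply, scaleArrows_ofPath, map_smul, scaleArrows_ofPath]
    congr 1
    rw [smul_smul, ← Units.val_mul, mul_comm, hw, Units.val_one, one_smul, AlgHom.id_apply]

/-- Rescaling multiplies each path by a scalar, so path generators stay in the ideal. This is where
monomiality enters. -/
theorem le_comap_scaleArrows {I : Ideal (PathAlgebra k V)} (hI : IsMonomialIdeal I)
    (d : (Σ a b : V, (a ⟶ b)) → kˣ) : I ≤ I.comap (scaleArrows d) := by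
  obtain ⟨S, rfl⟩ := hI
  intro x hx
  rw [TwoSidedIdeal.mem_asIdeal] at hx
  rw [Ideal.mem_comap, TwoSidedIdeal.mem_asIdeal]
  have : TwoSidedIdeal.span ((fun p : QuiverPath V => ofPath k p.2.2) '' S) ≤
      (TwoSidedIdeal.span ((fun p : QuiverPath V => ofPath k p.2.2) '' S)).comap
        (scaleArrows d) := by
    rw [TwoSidedIdeal.span_le]
    rintro _ ⟨p, hp, rfl⟩
    rw [SetLike.mem_coe, TwoSidedIdeal.mem_comap]
    change scaleArrows d (ofPath k p.2.2) ∈ _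
    rw [scaleArrows_ofPath, Algebra.smul_def]
    exact TwoSidedIdeal.mul_mem_left _ _ _ (TwoSidedIdeal.subset_span ⟨p, hp, rfl⟩)
  exact (TwoSidedIdeal.mem_comap _).1 (this hx)

end PathAlgebra

/-! ### Automorphisms of $kQ/I$ and the orbits on $\operatorname{msa}(Q)$. -/

section

open TruncatedQuiverAlgebra

variable {k : Type w} [Field k] {V : Type u} [Quiver.{v} V] [Fintype V]
  (I : Ideal (PathAlgebra k V)) [hI : IsAdmissibleIdeal I]

/-- Scaling of arrows gives automorphisms of a monomial algebra. -/
theorem exists_aut_scaleArrows (h : IsMonomialIdeal I) (d : (Σ a b : V, (a ⟶ b)) → kˣ) :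
    ∃ φ : (PathAlgebra k V ⧸ I) ≃ₐ[k] (PathAlgebra k V ⧸ I),
      (∀ a, inducedAut I φ (vertex k a) = vertex k a) ∧
      ∀ (a b : V) (e : a ⟶ b),
        inducedAut I φ (arrow k e) = (d ⟨a, b, e⟩ : k) • arrow k e := by
  have hinv (d d' : (Σ a b : V, (a ⟶ b)) → kˣ) (hd : d * d' = 1) :
      (Ideal.quotientMapₐ I (scaleArrows d) (le_comap_scaleArrows h d)).comp
        (Ideal.quotientMapₐ I (scaleArrows d') (le_comap_scaleArrows h d')) =
          AlgHom.id k (PathAlgebra k V ⧸ I) := by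
    refine AlgHom.ext fun x => ?_
    obtain ⟨x, rfl⟩ := Ideal.Quotient.mk_surjective x
    exact congrArg (Ideal.Quotient.mk I) (DFunLike.congr_fun (scaleArrows_comp_of_mul_eq_one hd) x)
  refine ⟨AlgEquiv.ofAlgHom _ _ (hinv d d⁻¹ (mul_inv_cancel d)) (hinv d⁻¹ d (inv_mul_cancel d)),
    ?_, ?_⟩
  · intro a
    change Ideal.Quotient.mk _ (scaleArrows d (ofPath k Quiver.Path.nil)) = _
    rw [scaleArrows_ofPath, Quiver.Path.weight_nil, Units.val_one, one_smul]
    rfl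
  · intro a b e
    change Ideal.Quotient.mk _ (scaleArrows d (ofPath k e.toPath)) = _
    rw [scaleArrows_ofPath, Quiver.Hom.toPath, Quiver.Path.weight_cons, Quiver.Path.weight_nil,
      one_mul]
    rfl

/-- Conjugation by `1 + m`, for `m` in the radical of `T₂ Q`, is induced by an automorphism of
`kQ/I`. -/
theorem exists_aut_conj (m : TruncatedQuiverAlgebra k V 2) (hm : ∀ a, character k a m = 0) :
    ∃ φ : (PathAlgebra k V ⧸ I) ≃ₐ[k] (PathAlgebra k V ⧸ I),
      ∀ x, inducedAut I φ x = (1 + m) * x * (1 - m) := by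
  have hmm : m * m = 0 := mul_eq_zero_of_character hm hm
  obtain ⟨m, rfl⟩ := Ideal.Quotient.mk_surjective m
  obtain ⟨l, _, hl⟩ := hI.exists_pow_le
  have hnil : IsNilpotent (Ideal.Quotient.mk I m) := by
    refine ⟨l, ?_⟩
    rw [← map_pow, Ideal.Quotient.eq_zero_iff_mem]
    exact hl (Ideal.pow_mem_pow ((mem_arrowIdeal_iff k m).2 hm) l)
  obtain ⟨c, hc⟩ := hnil.isUnit_one_add
  have hc1 : toT2 I c = 1 + Ideal.Quotient.mk (arrowIdeal k V ^ 2) m := by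
    rw [hc, map_add, map_one, toT2_mk]
  -- The inverse of $1+m$ in $kQ/I$ may involve higher powers of the lift, but its image in $T_2Q$
  -- is $1-m$ since $m^2=0$ there.
  have hc2 : toT2 I (↑c⁻¹ : PathAlgebra k V ⧸ I) =
      1 - Ideal.Quotient.mk (arrowIdeal k V ^ 2) m := by
    refine left_inv_eq_right_inv (a := toT2 I c) ?_ ?_
    · rw [← map_mul, Units.inv_mul, map_one]
    · rw [hc1, mul_sub, mul_one, add_mul, one_mul, hmm, add_zero, add_sub_cancel_right]
  refine ⟨MulSemiringAction.toAlgEquiv k (PathAlgebra k V ⧸ I) (ConjAct.toConjAct c), fun x => ?_⟩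
  obtain ⟨x, rfl⟩ := toT2_surjective I x
  rw [inducedAut_toT2, MulSemiringAction.toAlgEquiv_apply, ConjAct.units_smul_def, map_mul,
    map_mul, ConjAct.ofConjAct_toConjAct, hc1, hc2]

/-- A hyperplane of a finite-dimensional vector space is the kernel of a nonzero functional. -/
theorem Submodule.exists_eq_ker_of_finrank {M : Type*} [AddCommGroup M] [Module k M]
    [Module.Finite k M] (W : Submodule k M) (hM : Module.finrank k M ≠ 0)
    (hW : Module.finrank k W = Module.finrank k M - 1) :
    ∃ f : M →ₗ[k] k, f ≠ 0 ∧ ∀ x, x ∈ W ↔ f x = 0 := by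
  have h1 : Module.finrank k (M ⧸ W) = Module.finrank k k := by
    have := W.finrank_quotient_add_finrank
    rw [Module.finrank_self]
    omega
  let e := LinearEquiv.ofFinrankEq _ _ h1
  have hf (x : M) : x ∈ W ↔ (e.toLinearMap ∘ₗ W.mkQ) x = 0 := by simp
  refine ⟨_, fun h => ?_, hf⟩
  have : W = ⊤ := by
    rw [Submodule.eq_top_iff']
    intro x
    rw [hf, h, LinearMap.zero_apply]
  rw [this, finrank_top] at hW
  omega

theorem msa.mem_orbit_of_forall_mem_iff (A A' : msa k V)
    (φ : (PathAlgebra k V ⧸ I) ≃ₐ[k] (PathAlgebra k V ⧸ I))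
    (h : ∀ x, inducedAut I φ x ∈ A.1 ↔ x ∈ A'.1) :
    A ∈ MulAction.orbit ((PathAlgebra k V ⧸ I) ≃ₐ[k] (PathAlgebra k V ⧸ I)) A' := by
  refine ⟨φ, Subtype.ext ?_⟩
  change A'.1.map (inducedAut I φ).toAlgHom = A.1
  ext x
  rw [Subalgebra.mem_map]
  constructor
  · rintro ⟨y, hy, rfl⟩
    exact (h y).2 hy
  · intro hx
    obtain ⟨y, rfl⟩ := (inducedAut I φ).surjective x
    exact ⟨y, (h y).1 hx, rfl⟩

/-- `msa.HasType I A t` relates a subalgebra `A` of codimension one to a pair of vertices that it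
identifies, or to the set of arrows that support a functional defining a translate of `A`. -/
def msa.HasType (A : msa k V) : (V × V) ⊕ Set (Σ a b : V, (a ⟶ b)) → Prop
  | .inl p => A.1 = AlgHom.equalizer (character k p.1) (character k p.2)
  | .inr s => ∃ (φ : (PathAlgebra k V ⧸ I) ≃ₐ[k] (PathAlgebra k V ⧸ I))
      (g : TruncatedQuiverAlgebra k V 2 →ₗ[k] k) (u v : V),
      (∀ x, inducedAut I φ x ∈ A.1 ↔ g x = 0) ∧ (∀ a, g (vertex k a) = 0) ∧
      (∀ e : Σ a b : V, (a ⟶ b), g (arrow k e.2.2) ≠ 0 ↔ e ∈ s) ∧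
      ∀ e : Σ a b : V, (a ⟶ b), e ∈ s → e.1 = u ∧ e.2.1 = v

theorem msa.exists_hasType [∀ a b : V, Finite (a ⟶ b)] [Nonempty V] (A : msa k V) :
    ∃ t, msa.HasType I A t := by
  -- Ensures $n\ne 0$, so that the truncated difference $n-1$ really means codimension one.
  have : Nontrivial (TruncatedQuiverAlgebra k V 2) :=
    (character k (Classical.arbitrary V)).toRingHom.domain_nontrivial
  obtain ⟨f, hf, hA⟩ := (Subalgebra.toSubmodule A.1).exists_eq_ker_of_finrank
    Module.finrank_pos.ne' A.2
  by_cases hrad : ∀ x, (∀ a, character k a x = 0) → f x = 0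
  · obtain ⟨u, v, h⟩ := exists_eq_equalizer A.1 f hf hA hrad
    exact ⟨.inl (u, v), h⟩
  · push Not at hrad
    obtain ⟨u, v, m, g, hm, hg, hgv, hga⟩ := exists_normal_form A.1 f hA hrad
    obtain ⟨φ, hφ⟩ := exists_aut_conj I m hm
    refine ⟨.inr {e | g (arrow k e.2.2) ≠ 0}, φ, g, u, v, fun x => ?_, hgv, fun _ => Iff.rfl,
      fun e he => hga _ _ _ he⟩
    rw [hφ, hg]

/-- Two functionals with the same support in the arrows differ by a scalar (Schur) or by a rescaling
of arrows (monomial), so the type is fine enough to determine the orbit. -/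
theorem msa.mem_orbit_of_hasType (h : IsSchurQuiver V ∨ IsMonomialIdeal I) {A A' : msa k V}
    {t : (V × V) ⊕ Set (Σ a b : V, (a ⟶ b))} (hA : msa.HasType I A t)
    (hA' : msa.HasType I A' t) :
    A ∈ MulAction.orbit ((PathAlgebra k V ⧸ I) ≃ₐ[k] (PathAlgebra k V ⧸ I)) A' := by
  match t with
  | .inl p =>
    have : A = A' := Subtype.ext (hA.trans hA'.symm)
    rw [this]
    exact MulAction.mem_orbit_self A'
  | .inr s =>
    obtain ⟨φ, g, u, v, hφ, hgv, hgs, hs⟩ := hA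
    obtain ⟨φ', g', -, -, hφ', hgv', hgs', -⟩ := hA'
    suffices ∃ θ : (PathAlgebra k V ⧸ I) ≃ₐ[k] (PathAlgebra k V ⧸ I),
        ∀ x, g (inducedAut I θ x) = 0 ↔ g' x = 0 by
      obtain ⟨θ, hθ⟩ := this
      -- The composite carries $A'$ to $\ker g'$, then to $\ker g$, then to $A$.
      apply msa.mem_orbit_of_forall_mem_iff I A A' (φ * θ * φ'⁻¹)
      intro x
      obtain ⟨y, rfl⟩ := (inducedAut I φ').surjective x
      rw [hφ', ← hθ, ← hφ, ← AlgEquiv.mul_apply, ← AlgEquiv.mul_apply, ← map_mul, ← map_mul,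
        inv_mul_cancel_right, map_mul, AlgEquiv.mul_apply]
    have hzero (e : Σ a b : V, (a ⟶ b)) (he : e ∉ s) :
        g (arrow k e.2.2) = 0 ∧ g' (arrow k e.2.2) = 0 :=
      ⟨not_not.1 fun h => he ((hgs e).1 h), not_not.1 fun h => he ((hgs' e).1 h)⟩
    rcases h with h | h
    · suffices ∃ c : k, c ≠ 0 ∧ g = c • g' by
        obtain ⟨c, hc, rfl⟩ := this
        exact ⟨1, fun x => by simp [hc]⟩
      by_cases hse : s.Nonempty
      · obtain ⟨e, he⟩ := hse
        have he1 := (hgs e).2 he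
        have he2 := (hgs' e).2 he
        refine ⟨g (arrow k e.2.2) / g' (arrow k e.2.2), div_ne_zero he1 he2,
          linearMap_ext (fun a => by simp [hgv, hgv']) fun a b e' => ?_⟩
        by_cases he' : (⟨a, b, e'⟩ : Σ a b : V, (a ⟶ b)) ∈ s
        · obtain ⟨rfl, rfl⟩ := hs _ he'
          obtain ⟨a', b', e⟩ := e
          obtain ⟨h1, h2⟩ := hs _ he
          dsimp only at h1 h2
          subst h1 h2
          obtain rfl := (h a' b').elim e e'
          simp [he2]
        · obtain ⟨h1, h2⟩ := hzero _ he'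
          dsimp only at h1 h2
          simp [h1, h2]
      -- With empty support both functionals are zero.
      · refine ⟨1, one_ne_zero, linearMap_ext (fun a => by simp [hgv, hgv']) fun a b e => ?_⟩
        obtain ⟨h1, h2⟩ := hzero ⟨a, b, e⟩ fun h => hse ⟨_, h⟩
        dsimp only at h1 h2
        simp [h1, h2]
    -- The scaling factor is $g'/g$ on the support; off it both values are zero and $1$ serves.
    · have hd (e : Σ a b : V, (a ⟶ b)) :
          ∃ d : kˣ, (d : k) * g (arrow k e.2.2) = g' (arrow k e.2.2) := by
        by_cases he : e ∈ s
        · have he1 := (hgs e).2 he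
          exact ⟨Units.mk0 _ (div_ne_zero ((hgs' e).2 he) he1), div_mul_cancel₀ _ he1⟩
        · exact ⟨1, by simp [hzero e he]⟩
      choose d hd using hd
      obtain ⟨θ, hθv, hθa⟩ := exists_aut_scaleArrows I h d
      have : g ∘ₗ (inducedAut I θ).toLinearMap = g' := by
        refine linearMap_ext (fun a => ?_) fun a b e => ?_
        · simp [hθv, hgv, hgv']
        · simpa [hθa] using hd ⟨a, b, e⟩
      exact ⟨θ, fun x => by rw [← this]; rfl⟩

end

end

theorem mainTheorem4 {k : Type w} [Field k] [IsAlgClosed k]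
    {V : Type u} [Quiver.{v} V] [Fintype V] [∀ a b : V, Finite (a ⟶ b)]
    (I : Ideal (PathAlgebra k V)) [IsAdmissibleIdeal I]
    (h : IsSchurQuiver V ∨ IsMonomialIdeal I) :
    ∃ S : Set (msa k V), S.Finite ∧
      (⋃ A ∈ S, MulAction.orbit ((PathAlgebra k V ⧸ I) ≃ₐ[k] (PathAlgebra k V ⧸ I)) A) =
        Set.univ := by
  cases isEmpty_or_nonempty V with
  | inl hV =>
    -- Without vertices $T_2Q=0$, and the truncated $n-1$ is $0$; the zero algebra has just one
    -- subalgebra.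
    have : Subsingleton (TruncatedQuiverAlgebra k V 2) := by
      refine subsingleton_of_zero_eq_one ?_
      rw [← TruncatedQuiverAlgebra.sum_vertex k V, Finset.univ_eq_empty, Finset.sum_empty]
    have : Subsingleton (msa k V) := ⟨fun A A' => Subtype.ext (by
      ext x
      rw [Subsingleton.elim x 0]
      exact iff_of_true A.1.zero_mem A'.1.zero_mem)⟩
    exact ⟨Set.univ, Set.toFinite _, Set.eq_univ_of_forall fun A =>
      Set.mem_biUnion (Set.mem_univ A) (MulAction.mem_orbit_self A)⟩
  | inr hV =>
    -- One representative is chosen per realized type; types are finite in number because vertices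
    -- and arrows are.
    let T := {t // ∃ A : msa k V, msa.HasType I A t}
    choose F hF using fun t : T => t.2
    refine ⟨Set.range F, Set.finite_range F, Set.eq_univ_of_forall fun A => ?_⟩
    obtain ⟨t, ht⟩ := msa.exists_hasType I A
    exact Set.mem_biUnion (Set.mem_range_self (⟨t, A, ht⟩ : T))
      (msa.mem_orbit_of_hasType I h ht (hF ⟨t, A, ht⟩))
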